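/- Let $N\ge 1$ be an integer, $\alpha>0$ and $\delta>0$. For each tenant $n\in\{1,\dots,N\}$ let $c_n:\mathbb R\to\mathbb R$ be continuous, with $c_n(s)=0$ for $s\le 0$, and convex and strictly increasing on $[0,\infty)$. Write $\partial^+c_n$ for the right derivative. Let $F$ be the set of all $(s,y)\in\mathbb R^N\times\mathbb R$ with $\sum_n s_n=\delta-y$, $y\ge0$ and $s_n\ge 0$ for all $n$. Assume moreover: (i) (cheap on-site generation) the social cost $\alpha y+\sum_n c_n(s_n)$ has a minimizer $(s^*,y^*)$ over $F$ with $y^*>0$; (ii) $\partial^+c_n(0)\ge \frac{\alpha}{2N}$ for every $n$. For a bid vector $\mathbf b\in[0,\infty)^N$, the payoff of tenant $n$ is $$Q_n(b_n;\mathbf b_{-n})=\sqrt{\frac{(\sum_m b_m)\alpha\delta}{N}}-b_n-c_n\!\left(\delta-\frac{b_n}{\sqrt{\sum_m b_m}}\sqrt{\frac{N\delta}{\alpha}}\right)\qquad (\text{with } 0/0=0),$$ and for $0\le y\le\delta$ put $p(\mathbf b,y)=\frac{\sum_m b_m}{(N-1)\delta+y}$. When $N=1$ the level $y=0$, at which this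 price is not finite, is excluded. A triple $(\mathbf b,p,y)$ with $\mathbf b\in[0,\infty)^N$ and $p,y\in\mathbb R$ is a price-anticipating market equilibrium if - $Q_n(b_n;\mathbf b_{-n})\ge Q_n(\bar b_n;\mathbf b_{-n})$ for all $\bar b_n\ge 0$ and all $n$; - $p=p(\mathbf b,y)$; - $y$ minimizes $(\delta-y')\,p(\mathbf b,y')+\alpha y'$ over the admissible $y'\in[0,\delta]$. For $s<0$ put $\hat c_n(s)=0$, and for $s\ge0$ $$\hat c_n(s)=\frac12\left(c_n(s)+\frac{\alpha s}{2N}\right)+\frac12\int_0^s\sqrt{\left(\partial^+c_n(z)-\frac{\alpha}{2N}\right)^2+2\,\partial^+c_n(z)\,\frac{z\alpha}{N\delta}}\;dz .$$ Theorem. The integrand above is integrable on $[0,s]$ for all $s\ge 0$ and all $n$, and there is exactly one price-anticipating market equilibrium $(\mathbf b^a,p^a,y^a)$. It has $p^a>0$, and the allocation $(\mathbf s^a,y^a)$ with $s^a_n=\delta-b^a_n/p^a$ is the unique minimizer of $$\sum_n\hat c_n(s_n)+\frac{\alpha}{2N\delta}\bigl(y+(N-1)\delta\bigr)^2\quad\text{subject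 to}\quad \sum_n s_n=\delta-y,\quad y\ge0,\quad s_n\ge0\ \ (n=1,\dots,N).$$ -/

import Mathlib

open scoped BigOperators

namespace ColoEDR

noncomputable section

/-- A tenant cost function: continuous, zero on `(-∞, 0]`, and convex and strictly increasing on
`[0, ∞)`. -/
structure IsTenantCost (c : ℝ → ℝ) : Prop where
  continuous : Continuous c
  zero_of_nonpos : ∀ s : ℝ, s ≤ 0 → c s = 0
  convexOn : ConvexOn ℝ (Set.Ici 0) c
  strictMonoOn : StrictMonoOn c (Set.Ici 0)

/-- The right derivative `∂⁺f(x)`. -/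
def rightDeriv (f : ℝ → ℝ) (x : ℝ) : ℝ := derivWithin f (Set.Ioi x) x

/-- The supply function `S(b, p) = δ - b / p`. -/
def supply (δ b p : ℝ) : ℝ := δ - b / p

/-- The market clearing price `p(b, y) = (∑ b) / ((N - 1) δ + y)`. -/
def clearingPrice {N : ℕ} (δ : ℝ) (b : Fin N → ℝ) (y : ℝ) : ℝ :=
  (∑ i, b i) / (((N : ℝ) - 1) * δ + y)

/-- The operator's cost `(δ - y) p(b, y) + α y`. -/
def operatorCost {N : ℕ} (α δ : ℝ) (b : Fin N → ℝ) (y : ℝ) : ℝ :=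
  (δ - y) * clearingPrice δ b y + α * y

/-- The on-site generation levels `0 ≤ y ≤ δ` at which the clearing price is finite. The second
condition only removes `y = 0` when `N = 1`, where the price is `x / 0 = +∞` for a positive bid
`x` (so that `y = 0` is never cost minimizing), whereas real division would give `0` in Lean. -/
def generationLevels (N : ℕ) (δ : ℝ) : Set ℝ :=
  {y | 0 ≤ y ∧ y ≤ δ ∧ 0 < ((N : ℝ) - 1) * δ + y}

/-- The payoff of the price-anticipating tenant `n` at the bid vector `b`:
`√((∑ b) α δ / N) - b_n - c_n (δ - b_n / √(∑ b) * √(N δ / α))`, with the convention `0 / 0 = 0`. -/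
def payoff {N : ℕ} (α δ : ℝ) (c : Fin N → ℝ → ℝ) (n : Fin N) (b : Fin N → ℝ) : ℝ :=
  Real.sqrt ((∑ i, b i) * α * δ / N) - b n
    - c n (δ - b n / Real.sqrt (∑ i, b i) * Real.sqrt (N * δ / α))

/-- `(b, p, y)` is a price-anticipating market equilibrium. -/
structure IsEquilibrium {N : ℕ} (α δ : ℝ) (c : Fin N → ℝ → ℝ)
    (b : Fin N → ℝ) (p y : ℝ) : Prop where
  bid_nonneg : ∀ n, 0 ≤ b n
  payoff_max : ∀ n, ∀ b' : ℝ, 0 ≤ b' →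
    payoff α δ c n (Function.update b n b') ≤ payoff α δ c n b
  price_eq : p = clearingPrice δ b y
  generation_mem : y ∈ generationLevels N δ
  generation_min : IsMinOn (operatorCost α δ b) (generationLevels N δ) y

/-- The feasible allocations `(s, y)`: `∑ s_n = δ - y`, `s ≥ 0`, `y ≥ 0`. -/
def feasible (N : ℕ) (δ : ℝ) : Set ((Fin N → ℝ) × ℝ) :=
  {q | ∑ n, q.1 n = δ - q.2 ∧ (∀ n, 0 ≤ q.1 n) ∧ 0 ≤ q.2}

/-- The social cost `α y + ∑ c_n(s_n)`. -/
def socialCost {N : ℕ} (α : ℝ) (c : Fin N → ℝ → ℝ) (q : (Fin N → ℝ) × ℝ) : ℝ :=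
  α * q.2 + ∑ n, c n (q.1 n)

/-- On-site generation is cheap: a socially optimal allocation uses a nonzero amount of it. -/
def CheapOnSite {N : ℕ} (α δ : ℝ) (c : Fin N → ℝ → ℝ) : Prop :=
  ∃ q ∈ feasible N δ, IsMinOn (socialCost α c) (feasible N δ) q ∧ 0 < q.2

/-- The integrand
`√((∂⁺c(z) - α / (2N))² + 2 ∂⁺c(z) z α / (N δ))` of the modified cost. -/
def modifiedIntegrand (N : ℕ) (α δ : ℝ) (c : ℝ → ℝ) (z : ℝ) : ℝ :=
  Real.sqrt ((rightDeriv c z - α / (2 * N)) ^ 2 + 2 * rightDeriv c z * (z * α / (N * δ)))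

/-- The modified cost `ĉ`. -/
def modifiedCost (N : ℕ) (α δ : ℝ) (c : ℝ → ℝ) (s : ℝ) : ℝ :=
  if s < 0 then 0
  else 1 / 2 * (c s + s * (α / (2 * N)))
    + 1 / 2 * ∫ z in (0 : ℝ)..s, modifiedIntegrand N α δ c z

/-- The objective `∑ ĉ_n(s_n) + α / (2 N δ) (y + (N - 1) δ)²`. -/
def modifiedObjective {N : ℕ} (α δ : ℝ) (c : Fin N → ℝ → ℝ) (q : (Fin N → ℝ) × ℝ) : ℝ :=
  ∑ n, modifiedCost N α δ (c n) (q.1 n)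
    + α / (2 * N * δ) * (q.2 + ((N : ℝ) - 1) * δ) ^ 2

end

end ColoEDR

namespace ColoEDR

open Filter Topology Set

/-! ### Convex calculus for tenant costs on the whole line. -/

section Cost

variable {c : ℝ → ℝ}

/-! Write `a = α / (2N)` and `k² = Nδ / α`, and let `σ²` be the sum of the bids. Completing the
square shows that the operator's best response satisfies `y + (N - 1)δ = kσ`, so the price is `p = σ
/ k`, which is also the derivative in `y` of the quadratic term of the modified objective. With the
other bids fixed, tenant `n` in effect chooses `σ`, and its first order condition becomes `g (p - a
(1 - s_n / δ)) = p (p - a)` with `g` a subgradient of `c_n` at `s_n` (`foc_iff`). For `g =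
∂⁺c_n(s_n)` this is a quadratic equation in `p` whose larger root is `marginal`, the integrand that
produces `ĉ_n` (`IsTenant.marginal_root`). Equilibrium and minimality of the modified objective thus
have the same first order conditions, recorded in `IsKkt`.

Three implications carry the theorem. A point satisfying `IsKkt` is the strict minimizer of the
modified objective (`IsKkt.modifiedObjective_lt`) and comes from an equilibrium
(`IsKkt.exists_isEquilibrium`). A minimizer, which exists by compactness, satisfies `IsKkt`
(`isKkt_of_isMinOn`). So does the allocation of any equilibrium (`IsEquilibrium.isKkt`). The
allocation is therefore unique; `y` fixes the price, and price and supplies fix the bids.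

Cheap generation serves to force `y > 0`; the bound `∂⁺c_n(0) ≥ a` makes the relevant root the
larger one and `marginal` monotone. Since costs may have kinks, derivatives are replaced by
subgradients obtained as limits of secant inequalities. -/

lemma IsTenantCost.eq_comp_max (hc : IsTenantCost c) : c = c ∘ fun s => max s 0 := by
  funext s
  rcases le_total s 0 with h | h
  · simp [h, hc.zero_of_nonpos s h, hc.zero_of_nonpos 0 le_rfl]
  · simp [h]

lemma image_max_zero : (fun s : ℝ => max s 0) '' univ = Ici 0 := by
  ext s
  constructor
  · rintro ⟨t, -, rfl⟩
    exact le_max_right t 0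
  · intro hs
    exact ⟨s, mem_univ _, max_eq_left hs⟩

lemma IsTenantCost.monotone (hc : IsTenantCost c) : Monotone c := by
  rw [hc.eq_comp_max]
  intro s t h
  exact hc.strictMonoOn.monotoneOn (show max s 0 ∈ Ici (0 : ℝ) from le_max_right s 0)
    (show max t 0 ∈ Ici (0 : ℝ) from le_max_right t 0) (max_le_max_right 0 h)

/-- A convex increasing function after the convex map `max · 0`. Convexity on the whole line makes
`0` an interior point, so one-sided derivatives there need no special treatment. -/
lemma IsTenantCost.convexOn_univ (hc : IsTenantCost c) : ConvexOn ℝ univ c := by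
  rw [hc.eq_comp_max]
  refine ConvexOn.comp ?_ ((convexOn_id convex_univ).sup (convexOn_const 0 convex_univ)) ?_
  · rw [image_max_zero]
    exact hc.convexOn
  · exact hc.monotone.monotoneOn _

lemma IsTenantCost.hasDerivWithinAt_rightDeriv (hc : IsTenantCost c) (x : ℝ) :
    HasDerivWithinAt c (rightDeriv c x) (Ioi x) x :=
  hc.convexOn_univ.hasDerivWithinAt_rightDeriv_of_mem_interior (by simp)

lemma IsTenantCost.monotone_rightDeriv (hc : IsTenantCost c) : Monotone (rightDeriv c) := by
  have := hc.convexOn_univ.monotoneOn_rightDeriv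
  rw [interior_univ] at this
  exact monotoneOn_univ.1 this

lemma IsTenantCost.rightDeriv_mul_le (hc : IsTenantCost c) (x w : ℝ) :
    rightDeriv c x * (w - x) ≤ c w - c x := by
  rcases lt_trichotomy x w with h | rfl | h
  · have := hc.convexOn_univ.rightDeriv_le_slope_of_mem_interior (x := x) (y := w) (by simp)
      (mem_univ _) h
    rwa [slope_def_field, le_div_iff₀ (sub_pos.2 h)] at this
  · simp
  · have h1 := hc.convexOn_univ.slope_le_leftDeriv_of_mem_interior (x := w) (y := x) (mem_univ _)
      (by simp) h
    have h2 := h1.trans (hc.convexOn_univ.leftDeriv_le_rightDeriv_of_mem_interior (by simp))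
    rw [slope_def_field, div_le_iff₀ (sub_pos.2 h)] at h2
    change _ ≤ rightDeriv c x * _ at h2
    linarith

/-- A slope bound on a short interval to the right propagates to all larger arguments. -/
lemma IsTenantCost.mul_sub_le_of_right (hc : IsTenantCost c) {x e g : ℝ} (he : 0 < e)
    (h : ∀ z, x ≤ z → z ≤ x + e → g * (z - x) ≤ c z - c x) {w : ℝ} (hw : x ≤ w) :
    g * (w - x) ≤ c w - c x := by
  rcases le_or_gt w (x + e) with h1 | h1
  · exact h w hw h1
  · have h2 := hc.convexOn_univ.secant_mono_aux2 (mem_univ x) (mem_univ w)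
      (show x < x + e by linarith) h1
    have h3 := h (x + e) (by linarith) le_rfl
    have h4 : g ≤ (c (x + e) - c x) / (x + e - x) := by
      rw [le_div_iff₀ (by linarith)]; exact h3
    have h5 := h4.trans h2
    rwa [le_div_iff₀ (by linarith)] at h5

end Cost

/-! ### The modified cost and its marginal as a root of a quadratic. -/

section Marginal

variable {N : ℕ} {α δ : ℝ} {c : ℝ → ℝ}

/-- The right derivative of the modified cost. -/
noncomputable def marginal (N : ℕ) (α δ : ℝ) (c : ℝ → ℝ) (z : ℝ) : ℝ :=
  1 / 2 * (rightDeriv c z + α / (2 * N)) + 1 / 2 * modifiedIntegrand N α δ c z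

/-- The standing assumptions on the parameters and on one tenant. -/
structure IsTenant (N : ℕ) (α δ : ℝ) (c : ℝ → ℝ) : Prop extends IsTenantCost c where
  hN : 0 < N
  hα : 0 < α
  hδ : 0 < δ
  le_rightDeriv_zero : α / (2 * N) ≤ rightDeriv c 0

lemma IsTenant.share_pos (h : IsTenant N α δ c) : 0 < α / (2 * N) := by
  have := h.hα
  have : (0 : ℝ) < N := by exact_mod_cast h.hN
  positivity

lemma IsTenant.le_rightDeriv (h : IsTenant N α δ c) {z : ℝ} (hz : 0 ≤ z) :
    α / (2 * N) ≤ rightDeriv c z :=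
  h.le_rightDeriv_zero.trans (h.monotone_rightDeriv hz)

lemma IsTenant.integrand_eq (h : IsTenant N α δ c) (z : ℝ) :
    modifiedIntegrand N α δ c z = √((rightDeriv c z - α / (2 * N)) ^ 2 +
      4 * (α / (2 * N)) * (z / δ) * rightDeriv c z) := by
  have : (0 : ℝ) < N := by exact_mod_cast h.hN
  have := h.hδ
  unfold modifiedIntegrand
  congr 1
  field_simp
  ring

/-- Squaring preserves the order of `∂⁺c - a` only because it is nonnegative, which is the lower
bound on the right derivative at `0`. Monotonicity also yields integrability. -/
lemma IsTenant.monotoneOn_modifiedIntegrand (h : IsTenant N α δ c) :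
    MonotoneOn (modifiedIntegrand N α δ c) (Ici 0) := by
  intro z hz w hw hzw
  have hz : 0 ≤ z := hz
  have hδ := h.hδ
  have ha := h.share_pos
  have h1 := h.le_rightDeriv hz
  have h2 := h.monotone_rightDeriv hzw
  rw [h.integrand_eq, h.integrand_eq]
  apply Real.sqrt_le_sqrt
  have h3 : z / δ ≤ w / δ := by gcongr
  have h4 : 0 ≤ z / δ := by positivity
  have h0 : 0 ≤ rightDeriv c z := ha.le.trans h1
  apply add_le_add
  · apply pow_le_pow_left₀ <;> linarith
  · have := h.hα
    have : 0 ≤ 4 * (α / (2 * (N : ℝ))) := by positivity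
    gcongr
    exact mul_nonneg this (h4.trans h3)

lemma IsTenant.monotoneOn_marginal (h : IsTenant N α δ c) :
    MonotoneOn (marginal N α δ c) (Ici 0) := by
  intro z hz w hw hzw
  have h1 := h.monotoneOn_modifiedIntegrand hz hw hzw
  have h2 := h.monotone_rightDeriv hzw
  unfold marginal
  linarith

lemma IsTenant.intervalIntegrable_modifiedIntegrand (h : IsTenant N α δ c) {s u : ℝ}
    (hs : 0 ≤ s) (hu : 0 ≤ u) :
    IntervalIntegrable (modifiedIntegrand N α δ c) MeasureTheory.volume s u := by
  apply MonotoneOn.intervalIntegrable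
  apply h.monotoneOn_modifiedIntegrand.mono
  intro z hz
  exact (le_min hs hu).trans hz.1

lemma IsTenant.modifiedCost_sub (h : IsTenant N α δ c) {s u : ℝ} (hs : 0 ≤ s) (hu : 0 ≤ u) :
    modifiedCost N α δ c u - modifiedCost N α δ c s = ∫ z in s..u, marginal N α δ c z := by
  have hi := h.monotone_rightDeriv.intervalIntegrable (μ := MeasureTheory.volume) (a := s) (b := u)
  have hj := h.intervalIntegrable_modifiedIntegrand hs hu
  have h1 : ∫ z in s..u, rightDeriv c z = c u - c s :=
    intervalIntegral.integral_eq_sub_of_hasDeriv_right h.continuous.continuousOn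
      (fun x _ => h.hasDerivWithinAt_rightDeriv x) hi
  have h2 := intervalIntegral.integral_interval_sub_left
    (h.intervalIntegrable_modifiedIntegrand le_rfl hu)
    (h.intervalIntegrable_modifiedIntegrand le_rfl hs)
  have h3 : ∫ z in s..u, marginal N α δ c z =
      1 / 2 * ((c u - c s) + (u - s) * (α / (2 * N)))
        + 1 / 2 * ∫ z in s..u, modifiedIntegrand N α δ c z := by
    unfold marginal
    rw [intervalIntegral.integral_add ((hi.add (by simp)).const_mul _) (hj.const_mul _),
      intervalIntegral.integral_const_mul, intervalIntegral.integral_const_mul,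
      intervalIntegral.integral_add hi (by simp), h1, intervalIntegral.integral_const, smul_eq_mul]
  rw [h3, ← h2, modifiedCost, modifiedCost, if_neg hs.not_gt, if_neg hu.not_gt]
  ring

lemma IsTenant.intervalIntegrable_marginal (h : IsTenant N α δ c) {s u : ℝ}
    (hs : 0 ≤ s) (hu : 0 ≤ u) :
    IntervalIntegrable (marginal N α δ c) MeasureTheory.volume s u := by
  apply MonotoneOn.intervalIntegrable
  apply h.monotoneOn_marginal.mono
  intro z hz
  exact (le_min hs hu).trans hz.1

lemma IsTenant.mul_le_modifiedCost_sub (h : IsTenant N α δ c) {s u p : ℝ} (hs : 0 ≤ s)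
    (hsu : s ≤ u) (hp : ∀ z ∈ Ioo s u, p ≤ marginal N α δ c z) :
    p * (u - s) ≤ modifiedCost N α δ c u - modifiedCost N α δ c s := by
  rw [h.modifiedCost_sub hs (hs.trans hsu)]
  have := intervalIntegral.integral_mono_on_of_le_Ioo hsu intervalIntegrable_const
    (h.intervalIntegrable_marginal hs (hs.trans hsu)) hp (μ := MeasureTheory.volume)
  rw [intervalIntegral.integral_const, smul_eq_mul] at this
  linarith

lemma IsTenant.modifiedCost_sub_le (h : IsTenant N α δ c) {s u p : ℝ} (hs : 0 ≤ s)
    (hsu : s ≤ u) (hp : ∀ z ∈ Ioo s u, marginal N α δ c z ≤ p) :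
    modifiedCost N α δ c u - modifiedCost N α δ c s ≤ p * (u - s) := by
  rw [h.modifiedCost_sub hs (hs.trans hsu)]
  have := intervalIntegral.integral_mono_on_of_le_Ioo hsu
    (h.intervalIntegrable_marginal hs (hs.trans hsu)) intervalIntegrable_const hp (μ := MeasureTheory.volume)
  rw [intervalIntegral.integral_const, smul_eq_mul] at this
  linarith

lemma IsTenant.continuousOn_modifiedCost (h : IsTenant N α δ c) {u : ℝ} (hu : 0 ≤ u) :
    ContinuousOn (modifiedCost N α δ c) (Icc 0 u) := by
  have h1 := intervalIntegral.continuousOn_primitive_interval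
    (show MeasureTheory.IntegrableOn (marginal N α δ c) (uIcc 0 u) by
      rw [uIcc_of_le hu, ← intervalIntegrable_iff_integrableOn_Icc_of_le hu]
      exact h.intervalIntegrable_marginal le_rfl hu)
  rw [uIcc_of_le hu] at h1
  refine (h1.add (continuousOn_const (c := modifiedCost N α δ c 0))).congr ?_
  intro z hz
  have := h.modifiedCost_sub le_rfl hz.1
  change modifiedCost N α δ c z =
    (∫ x in (0 : ℝ)..z, marginal N α δ c x) + modifiedCost N α δ c 0
  linarith

/-- The marginal modified cost is the larger root of
`P (P - a) = c' (P - a (1 - z / δ))` with `a = α / (2 N)`. -/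
lemma IsTenant.marginal_root (h : IsTenant N α δ c) {z : ℝ} (hz : 0 ≤ z) (P : ℝ) :
    P * (P - α / (2 * N)) - rightDeriv c z * (P - α / (2 * N) * (1 - z / δ)) =
      (P - marginal N α δ c z) *
        (P - (rightDeriv c z + α / (2 * N) - marginal N α δ c z)) := by
  have ha := h.share_pos
  have hδ := h.hδ
  have h1 := h.le_rightDeriv hz
  have h0 : 0 ≤ rightDeriv c z := ha.le.trans h1
  have hD := Real.sq_sqrt (show 0 ≤ (rightDeriv c z - α / (2 * N)) ^ 2 +
      4 * (α / (2 * N)) * (z / δ) * rightDeriv c z by positivity)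
  rw [← h.integrand_eq] at hD
  unfold marginal
  linear_combination 1 / 4 * hD

lemma IsTenant.rightDeriv_le_marginal (h : IsTenant N α δ c) {z : ℝ} (hz : 0 ≤ z) :
    rightDeriv c z ≤ marginal N α δ c z := by
  have ha := h.share_pos
  have hδ := h.hδ
  have h1 := h.le_rightDeriv hz
  have h0 : 0 ≤ rightDeriv c z := ha.le.trans h1
  have : rightDeriv c z - α / (2 * N) ≤ modifiedIntegrand N α δ c z := by
    rw [h.integrand_eq]
    apply Real.le_sqrt_of_sq_le
    have : 0 ≤ 4 * (α / (2 * N)) * (z / δ) * rightDeriv c z := by positivity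
    linarith
  unfold marginal
  linarith

/-- The roots sum to `∂⁺c + a` and the larger is at least `∂⁺c ≥ a`, so the smaller is at most `a`.
A `P` above the larger root makes both factors of `IsTenant.marginal_root` nonnegative. -/
lemma IsTenant.rightDeriv_mul_le_of_marginal_le (h : IsTenant N α δ c) {z P : ℝ} (hz : 0 ≤ z)
    (hP : marginal N α δ c z ≤ P) :
    rightDeriv c z * (P - α / (2 * N) * (1 - z / δ)) ≤ P * (P - α / (2 * N)) := by
  have h1 := h.marginal_root hz P
  have h2 := h.rightDeriv_le_marginal hz
  have h3 := h.le_rightDeriv hz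
  have : 0 ≤ (P - marginal N α δ c z) *
        (P - (rightDeriv c z + α / (2 * N) - marginal N α δ c z)) :=
    mul_nonneg (by linarith) (by linarith)
  linarith

/-- Here `P` lies between the two roots, since the smaller one is at most `a`. -/
lemma IsTenant.le_rightDeriv_mul_of_le_marginal (h : IsTenant N α δ c) {z P : ℝ} (hz : 0 ≤ z)
    (haP : α / (2 * N) ≤ P) (hP : P ≤ marginal N α δ c z) :
    P * (P - α / (2 * N)) ≤ rightDeriv c z * (P - α / (2 * N) * (1 - z / δ)) := by
  have h1 := h.marginal_root hz P
  have h2 := h.rightDeriv_le_marginal hz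
  have : (P - marginal N α δ c z) *
        (P - (rightDeriv c z + α / (2 * N) - marginal N α δ c z)) ≤ 0 :=
    mul_nonpos_of_nonpos_of_nonneg (by linarith) (by linarith)
  linarith

lemma IsTenant.marginal_lt (h : IsTenant N α δ c) {z P : ℝ} (hz : 0 ≤ z)
    (haP : α / (2 * N) ≤ P)
    (hP : rightDeriv c z * (P - α / (2 * N) * (1 - z / δ)) < P * (P - α / (2 * N))) :
    marginal N α δ c z < P := by
  by_contra! hlt
  exact absurd (h.le_rightDeriv_mul_of_le_marginal hz haP hlt) hP.not_ge

lemma IsTenant.lt_marginal (h : IsTenant N α δ c) {z P : ℝ} (hz : 0 ≤ z)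
    (hP : P * (P - α / (2 * N)) < rightDeriv c z * (P - α / (2 * N) * (1 - z / δ))) :
    P < marginal N α δ c z := by
  by_contra! hlt
  exact absurd (h.rightDeriv_mul_le_of_marginal_le hz hlt) hP.not_ge

end Marginal

/-- The market price at the generation level `y`, when `y` is the operator's optimal choice. -/
noncomputable def price (N : ℕ) (α δ y : ℝ) : ℝ := α / (N * δ) * (y + ((N : ℝ) - 1) * δ)

lemma sum_apply_update {ι : Type*} [Fintype ι] [DecidableEq ι] (f : ι → ℝ → ℝ) (s : ι → ℝ)
    (n : ι) (v : ℝ) :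
    ∑ m, f m (Function.update s n v m) = ∑ m, f m (s m) + f n v - f n (s n) := by
  rw [← Finset.add_sum_erase Finset.univ (fun m => f m (Function.update s n v m))
      (Finset.mem_univ n),
    ← Finset.add_sum_erase Finset.univ (fun m => f m (s m)) (Finset.mem_univ n),
    Finset.sum_congr rfl fun m hm => by
      rw [Function.update_of_ne (Finset.ne_of_mem_erase hm)], Function.update_self]
  ring

lemma update_mem_feasible {N : ℕ} {δ y d : ℝ} {s : Fin N → ℝ} (hf : (s, y) ∈ feasible N δ)
    (n : Fin N) (hd : 0 ≤ s n + d) (hyd : d ≤ y) :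
    (Function.update s n (s n + d), y - d) ∈ feasible N δ := by
  obtain ⟨h1, h2, h3⟩ := hf
  simp only at h1 h2 h3
  refine ⟨?_, ?_, by simpa using hyd⟩
  · have := sum_apply_update (fun _ z => z) s n (s n + d)
    simp only at this ⊢
    linarith
  · intro m
    by_cases hm : m = n
    · subst hm; simpa using hd
    · simpa [hm] using h2 m

/-! ### Passing between subgradients of `c` and of the modified cost. -/

section Subgradient

variable {N : ℕ} {α δ : ℝ} {c : ℝ → ℝ}

/-- Strictness holds even where `c` is affine: in the quadratic relation the factor `p - a (1 - z /
δ)` is strictly increasing in `z`, and `∂⁺c > 0` there. Hence `marginal` is strictly below `p` to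
the left of `s` and strictly above it to the right. -/
lemma IsTenant.mul_sub_lt_modifiedCost_sub (h : IsTenant N α δ c) {s p g u : ℝ} (hs : 0 ≤ s)
    (hp : α / (2 * N) ≤ p) (hg : g * (p - α / (2 * N) * (1 - s / δ)) = p * (p - α / (2 * N)))
    (hsub : ∀ w, g * (w - s) ≤ c w - c s) (hu : 0 ≤ u) (hus : u ≠ s) :
    p * (u - s) < modifiedCost N α δ c u - modifiedCost N α δ c s := by
  have ha := h.share_pos
  have hδ := h.hδ
  have hD : 0 ≤ p - α / (2 * N) * (1 - s / δ) := by
    have : 0 ≤ α / (2 * N) * (s / δ) := by positivity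
    linarith
  rcases lt_or_gt_of_ne hus with hlt | hlt
  · have key : ∀ z, 0 ≤ z → z < s → marginal N α δ c z < p := by
      intro z hz hzs
      apply h.marginal_lt hz hp
      have h1 := h.rightDeriv_mul_le z s
      have h2 : rightDeriv c z ≤ g := by
        have := hsub z
        nlinarith
      have h3 : 0 < rightDeriv c z := ha.trans_le (h.le_rightDeriv hz)
      have h4 : z / δ < s / δ := by gcongr
      rw [← hg]
      refine lt_of_lt_of_le ?_ (mul_le_mul_of_nonneg_right h2 hD)
      gcongr
    -- The midpoint turns pointwise strictness into strictness of the integral: on the half away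
    -- from `s` the marginal is bounded by its midpoint value, which is strictly less than `p`.
    have hm : (u + s) / 2 ∈ Ioo u s := ⟨by linarith, by linarith⟩
    have hm0 : 0 ≤ (u + s) / 2 := hu.trans hm.1.le
    have h1 := h.modifiedCost_sub_le hu hm.1.le
      (p := marginal N α δ c ((u + s) / 2))
      fun z hz => h.monotoneOn_marginal (hu.trans hz.1.le) hm0 hz.2.le
    have h2 := h.modifiedCost_sub_le hm0 hm.2.le
      fun z hz => (key z (hm0.trans hz.1.le) hz.2).le
    have h3 := mul_lt_mul_of_pos_right (key _ hm0 hm.2) (sub_pos.2 hm.1)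
    linarith
  · have key : ∀ z, s < z → p < marginal N α δ c z := by
      intro z hzs
      have hz : 0 ≤ z := hs.trans hzs.le
      apply h.lt_marginal hz
      have h1 := h.rightDeriv_mul_le z s
      have h2 : g ≤ rightDeriv c z := by
        have := hsub z
        nlinarith
      have h3 : 0 < rightDeriv c z := ha.trans_le (h.le_rightDeriv hz)
      have h4 : s / δ < z / δ := by gcongr
      rw [← hg]
      refine lt_of_le_of_lt (mul_le_mul_of_nonneg_right h2 hD) ?_
      gcongr
    have hm : (s + u) / 2 ∈ Ioo s u := ⟨by linarith, by linarith⟩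
    have hm0 : 0 ≤ (s + u) / 2 := hs.trans hm.1.le
    have h1 := h.mul_le_modifiedCost_sub hm0 hm.2.le
      (p := marginal N α δ c ((s + u) / 2))
      fun z hz => h.monotoneOn_marginal hm0 (hm0.trans hz.1.le) hz.1.le
    have h2 := h.mul_le_modifiedCost_sub hs hm.1.le
      fun z hz => (key z hz.1).le
    have h3 := mul_lt_mul_of_pos_right (key _ hm.1) (sub_pos.2 hm.2)
    linarith

/-- Perturbing a minimizer bounds the marginal at `s - e` only up to an error `κ e`. The quadratic
relation turns this into a bound on the secant of `c` from `w` to `s - e`, and `e → 0` needs only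
continuity of `c`. -/
lemma IsTenant.subgradient_left (h : IsTenant N α δ c) {s p g κ : ℝ} (hs : 0 < s)
    (hp : α / (2 * N) ≤ p) (hκ : 0 ≤ κ) (hD : 0 < p - α / (2 * N) * (1 - s / δ))
    (hg : g * (p - α / (2 * N) * (1 - s / δ)) = p * (p - α / (2 * N)))
    (hH : ∀ e, 0 < e → e ≤ s → marginal N α δ c (s - e) ≤ p + κ * e) {w : ℝ} (hw : w < s) :
    g * (w - s) ≤ c w - c s := by
  have ha := h.share_pos
  have hδ := h.hδ
  have hc := h.continuous
  have h1 : (c (s - 0) - c w) * (p + κ * 0 - α / (2 * N) * (1 - (s - 0) / δ)) ≤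
      (p + κ * 0) * (p + κ * 0 - α / (2 * N)) * (s - 0 - w) := by
    refine le_of_tendsto_of_tendsto (b := 𝓝[>] (0 : ℝ))
      (f := fun e => (c (s - e) - c w) * (p + κ * e - α / (2 * N) * (1 - (s - e) / δ)))
      (g := fun e => (p + κ * e) * (p + κ * e - α / (2 * N)) * (s - e - w))
      ?_ ?_ ?_
    · exact (Continuous.tendsto (by fun_prop) 0).mono_left nhdsWithin_le_nhds
    · exact (Continuous.tendsto (by fun_prop) 0).mono_left nhdsWithin_le_nhds
    · filter_upwards [Ioo_mem_nhdsGT (show 0 < min s (s - w) from lt_min hs (by linarith))]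
        with e he
      have he1 : e < s := he.2.trans_le (min_le_left _ _)
      have he2 : e < s - w := he.2.trans_le (min_le_right _ _)
      have h2 := h.rightDeriv_mul_le (s - e) w
      have h3 := h.rightDeriv_mul_le_of_marginal_le (by linarith) (hH e he.1 he1.le)
      have h4 : 0 ≤ α / (2 * N) * ((s - e) / δ) :=
        mul_nonneg ha.le (div_nonneg (by linarith) hδ.le)
      have h5 : 0 ≤ κ * e := mul_nonneg hκ he.1.le
      calc _ ≤ (rightDeriv c (s - e) * (s - e - w)) *
            (p + κ * e - α / (2 * N) * (1 - (s - e) / δ)) := by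
            apply mul_le_mul_of_nonneg_right <;> linarith
        _ = (rightDeriv c (s - e) * (p + κ * e - α / (2 * N) * (1 - (s - e) / δ))) *
            (s - e - w) := by ring
        _ ≤ _ := mul_le_mul_of_nonneg_right h3 (by linarith)
  simp only [mul_zero, add_zero, sub_zero] at h1
  rw [← hg] at h1
  have h2 : (c s - c w) * (p - α / (2 * N) * (1 - s / δ)) ≤
      (g * (s - w)) * (p - α / (2 * N) * (1 - s / δ)) := by linarith
  have := le_of_mul_le_mul_right h2 hD
  linarith

lemma IsTenant.subgradient_right (h : IsTenant N α δ c) {s p g κ e₀ : ℝ} (hs : 0 ≤ s)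
    (hp : α / (2 * N) ≤ p) (hD : 0 < p - α / (2 * N) * (1 - s / δ))
    (hg : g * (p - α / (2 * N) * (1 - s / δ)) = p * (p - α / (2 * N))) (he₀ : 0 < e₀)
    (hH : ∀ e, 0 < e → e ≤ e₀ → p - κ * e ≤ marginal N α δ c (s + e)) {w : ℝ} (hw : s < w) :
    g * (w - s) ≤ c w - c s := by
  have ha := h.share_pos
  have hδ := h.hδ
  have hc := h.continuous
  have h1 : (p - κ * 0) * (p - κ * 0 - α / (2 * N)) * (w - (s + 0)) ≤
      (c w - c (s + 0)) * (p - κ * 0 - α / (2 * N) * (1 - (s + 0) / δ)) := by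
    refine le_of_tendsto_of_tendsto (b := 𝓝[>] (0 : ℝ))
      (f := fun e => (p - κ * e) * (p - κ * e - α / (2 * N)) * (w - (s + e)))
      (g := fun e => (c w - c (s + e)) * (p - κ * e - α / (2 * N) * (1 - (s + e) / δ)))
      ?_ ?_ ?_
    · exact (Continuous.tendsto (by fun_prop) 0).mono_left nhdsWithin_le_nhds
    · exact (Continuous.tendsto (by fun_prop) 0).mono_left nhdsWithin_le_nhds
    · have e1 : ∀ᶠ e in 𝓝[>] (0 : ℝ), 0 < p - κ * e :=
        ((Continuous.tendsto (f := fun e => p - κ * e) (by fun_prop) 0).mono_left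
          nhdsWithin_le_nhds).eventually_const_lt (by simp; linarith)
      have e2 : ∀ᶠ e in 𝓝[>] (0 : ℝ), 0 < p - κ * e - α / (2 * N) * (1 - (s + e) / δ) :=
        ((Continuous.tendsto (f := fun e => p - κ * e - α / (2 * N) * (1 - (s + e) / δ))
          (by fun_prop) 0).mono_left nhdsWithin_le_nhds).eventually_const_lt (by simpa using hD)
      filter_upwards [e1, e2, Ioo_mem_nhdsGT (show 0 < min e₀ (w - s) from
        lt_min he₀ (by linarith))] with e h5 h6 he
      have he1 : e < e₀ := he.2.trans_le (min_le_left _ _)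
      have he2 : e < w - s := he.2.trans_le (min_le_right _ _)
      have he0 : 0 < e := he.1
      have h2 := h.rightDeriv_mul_le (s + e) w
      have h3 : (p - κ * e) * (p - κ * e - α / (2 * N)) ≤
          rightDeriv c (s + e) * (p - κ * e - α / (2 * N) * (1 - (s + e) / δ)) := by
        -- The perturbed price may drop below `a`, where the root comparison is unavailable; then
        -- the left side is nonpositive and the right side nonnegative.
        rcases le_total (α / (2 * N)) (p - κ * e) with h7 | h7
        · exact h.le_rightDeriv_mul_of_le_marginal (by linarith) h7 (hH e he0 he1.le)
        · refine (mul_nonpos_of_nonneg_of_nonpos h5.le (by linarith)).trans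
            (mul_nonneg (ha.le.trans (h.le_rightDeriv (by linarith))) h6.le)
      calc _ ≤ (rightDeriv c (s + e) * (p - κ * e - α / (2 * N) * (1 - (s + e) / δ))) *
            (w - (s + e)) := mul_le_mul_of_nonneg_right h3 (by linarith)
        _ = (rightDeriv c (s + e) * (w - (s + e))) *
            (p - κ * e - α / (2 * N) * (1 - (s + e) / δ)) := by ring
        _ ≤ _ := mul_le_mul_of_nonneg_right h2 h6.le
  simp only [mul_zero, add_zero, sub_zero] at h1
  rw [← hg] at h1
  have h2 : (g * (w - s)) * (p - α / (2 * N) * (1 - s / δ)) ≤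
      (c w - c s) * (p - α / (2 * N) * (1 - s / δ)) := by linarith
  exact le_of_mul_le_mul_right h2 hD

end Subgradient

/-! ### Minimizers of the modified objective and their first order conditions. -/

section Market

variable {N : ℕ} {α δ : ℝ} {c : Fin N → ℝ → ℝ}

/-- The first order conditions shared by the equilibrium allocations and the minimizers of the
modified objective. -/
structure IsKkt (α δ : ℝ) (c : Fin N → ℝ → ℝ) (s : Fin N → ℝ) (y : ℝ) : Prop where
  generation_pos : 0 < y
  sum_eq : ∑ n, s n = δ - y
  nonneg : ∀ n, 0 ≤ s n
  le_price : α / (2 * N) ≤ price N α δ y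
  subgradient : ∀ n, ∃ g, g * (price N α δ y - α / (2 * N) * (1 - s n / δ)) =
    price N α δ y * (price N α δ y - α / (2 * N)) ∧ ∀ w, g * (w - s n) ≤ c n w - c n (s n)

lemma IsKkt.mem_feasible {s : Fin N → ℝ} {y : ℝ} (k : IsKkt α δ c s y) :
    (s, y) ∈ feasible N δ := ⟨k.sum_eq, k.nonneg, k.generation_pos.le⟩

/-- Each modified cost lies above its tangent of slope `price`, strictly off `s n`, and the
quadratic term has the same slope in `y`. Summed under the balance constraint the linear parts
cancel. Distinct feasible points differ in some `s n`, because `s` determines `y`. -/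
lemma IsKkt.modifiedObjective_lt (hT : ∀ n, IsTenant N α δ (c n)) (hN : 0 < N) (hα : 0 < α)
    (hδ : 0 < δ) {s : Fin N → ℝ} {y : ℝ} (k : IsKkt α δ c s y) {q : (Fin N → ℝ) × ℝ}
    (hq : q ∈ feasible N δ) (hne : q ≠ (s, y)) :
    modifiedObjective α δ c (s, y) < modifiedObjective α δ c q := by
  obtain ⟨u, x⟩ := q
  obtain ⟨hq1, hq2, hq3⟩ := hq
  simp only at hq1 hq2 hq3
  have hN' : (0 : ℝ) < N := by exact_mod_cast hN
  have lt : ∀ n, u n ≠ s n → price N α δ y * (u n - s n) <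
      modifiedCost N α δ (c n) (u n) - modifiedCost N α δ (c n) (s n) := fun n hn => by
    obtain ⟨g, hg, hsub⟩ := k.subgradient n
    exact (hT n).mul_sub_lt_modifiedCost_sub (k.nonneg n) k.le_price hg hsub (hq2 n) hn
  have le : ∀ n, price N α δ y * (u n - s n) ≤
      modifiedCost N α δ (c n) (u n) - modifiedCost N α δ (c n) (s n) := fun n => by
    by_cases hn : u n = s n
    · simp [hn]
    · exact (lt n hn).le
  have hex : ∃ n, u n ≠ s n := by
    by_contra! hall
    have : u = s := funext hall
    subst this
    have : x = y := by linarith [k.sum_eq]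
    exact hne (by rw [this])
  obtain ⟨n, hn⟩ := hex
  have hsum := Finset.sum_lt_sum (fun m (_ : m ∈ Finset.univ) => le m) ⟨n, Finset.mem_univ n, lt n hn⟩
  rw [← Finset.mul_sum, Finset.sum_sub_distrib, Finset.sum_sub_distrib, hq1, k.sum_eq] at hsum
  have hquad : α / (2 * N * δ) * (x + ((N : ℝ) - 1) * δ) ^ 2 -
      α / (2 * N * δ) * (y + ((N : ℝ) - 1) * δ) ^ 2 =
      price N α δ y * (x - y) + α / (2 * N * δ) * (x - y) ^ 2 := by
    unfold price
    field_simp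
    ring
  have : 0 ≤ α / (2 * N * δ) * (x - y) ^ 2 := by positivity
  simp only [modifiedObjective]
  linarith

/-- Compares the minimizer with the allocation that moves `d` from on-site generation to tenant `n`.
-/
lemma modifiedCost_le_of_isMinOn (hN : 0 < N) (hδ : 0 < δ) {s : Fin N → ℝ} {y : ℝ}
    (hf : (s, y) ∈ feasible N δ)
    (hmin : IsMinOn (modifiedObjective α δ c) (feasible N δ) (s, y)) (n : Fin N) {d : ℝ}
    (hd : 0 ≤ s n + d) (hyd : d ≤ y) :
    modifiedCost N α δ (c n) (s n) + price N α δ y * d - α / (2 * N * δ) * d ^ 2 ≤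
      modifiedCost N α δ (c n) (s n + d) := by
  have hN' : (0 : ℝ) < N := by exact_mod_cast hN
  have h4 := hmin (update_mem_feasible hf n hd hyd)
  simp only [mem_ofPred_eq, modifiedObjective] at h4
  rw [sum_apply_update (fun m => modifiedCost N α δ (c m))] at h4
  have hquad : α / (2 * N * δ) * (y - d + ((N : ℝ) - 1) * δ) ^ 2 -
      α / (2 * N * δ) * (y + ((N : ℝ) - 1) * δ) ^ 2 =
      - (price N α δ y * d) + α / (2 * N * δ) * d ^ 2 := by
    unfold price
    field_simp
    ring
  linarith

lemma marginal_sub_le_of_isMinOn (hT : ∀ n, IsTenant N α δ (c n)) (hN : 0 < N) (hδ : 0 < δ)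
    {s : Fin N → ℝ} {y : ℝ} (hf : (s, y) ∈ feasible N δ)
    (hmin : IsMinOn (modifiedObjective α δ c) (feasible N δ) (s, y)) (n : Fin N) (e : ℝ)
    (he : 0 < e) (hes : e ≤ s n) :
    marginal N α δ (c n) (s n - e) ≤ price N α δ y + α / (2 * N * δ) * e := by
  have hy : 0 ≤ y := hf.2.2
  have h1 := modifiedCost_le_of_isMinOn hN hδ hf hmin n (d := -e) (by linarith) (by linarith)
  have h2 := (hT n).mul_le_modifiedCost_sub (s := s n - e) (u := s n)
    (p := marginal N α δ (c n) (s n - e)) (by linarith) (by linarith)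
    fun z hz => (hT n).monotoneOn_marginal (show 0 ≤ s n - e by linarith)
      (show 0 ≤ z by linarith [hz.1]) hz.1.le
  rw [← sub_eq_add_neg] at h1
  have h3 : marginal N α δ (c n) (s n - e) * e ≤
      (price N α δ y + α / (2 * N * δ) * e) * e := by
    linarith
  exact le_of_mul_le_mul_right h3 he

lemma le_marginal_add_of_isMinOn (hT : ∀ n, IsTenant N α δ (c n)) (hN : 0 < N) (hδ : 0 < δ)
    {s : Fin N → ℝ} {y : ℝ} (hf : (s, y) ∈ feasible N δ)
    (hmin : IsMinOn (modifiedObjective α δ c) (feasible N δ) (s, y)) (n : Fin N) (e : ℝ)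
    (he : 0 < e) (hey : e ≤ y) :
    price N α δ y - α / (2 * N * δ) * e ≤ marginal N α δ (c n) (s n + e) := by
  have hs : 0 ≤ s n := hf.2.1 n
  have h1 := modifiedCost_le_of_isMinOn hN hδ hf hmin n (d := e) (by linarith) hey
  have h2 := (hT n).modifiedCost_sub_le (s := s n) (u := s n + e)
    (p := marginal N α δ (c n) (s n + e)) hs (by linarith)
    fun z hz => (hT n).monotoneOn_marginal (show 0 ≤ z by linarith [hz.1])
      (show 0 ≤ s n + e by linarith) hz.2.le
  have h3 : (price N α δ y - α / (2 * N * δ) * e) * e ≤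
      marginal N α δ (c n) (s n + e) * e := by
    linarith
  exact le_of_mul_le_mul_right h3 he

/-- If on-site generation is cheap, an allocation that does not use it has a tenant whose marginal
cost is at least `α` strictly below its allocation. -/
lemma CheapOnSite.exists_tenant (h : CheapOnSite α δ c) (hc : ∀ n, IsTenantCost (c n))
    {s : Fin N → ℝ} (hs : δ ≤ ∑ n, s n) :
    ∃ n, ∃ r, 0 ≤ r ∧ r < s n ∧ ∀ w, r ≤ w → α * (w - r) ≤ c n w - c n r := by
  obtain ⟨⟨u, y⟩, hf, hmin, hy⟩ := h
  obtain ⟨h1, h2, h3⟩ := hf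
  simp only at h1 h2 h3 hy
  -- The social optimum assigns the tenants only `δ - y < δ` in total, so one of them has less there
  -- than in `s`. Moving generation to that tenant cannot lower the social cost, so its slope is at
  -- least `α` on an interval of length `y`, and convexity extends this.
  have hex : ∃ n ∈ Finset.univ, u n < s n := Finset.exists_lt_of_sum_lt (by linarith)
  obtain ⟨n, -, hn⟩ := hex
  refine ⟨n, u n, h2 n, hn, fun w hw => (hc n).mul_sub_le_of_right hy ?_ hw⟩
  intro z hz hzy
  have h4 := hmin (update_mem_feasible ⟨h1, h2, h3⟩ n (d := z - u n)
    (by linarith [h2 n]) (by linarith))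
  rw [add_sub_cancel] at h4
  simp only [mem_ofPred_eq, socialCost] at h4
  rw [sum_apply_update c] at h4
  linarith

lemma exists_isMinOn_modifiedObjective (hT : ∀ n, IsTenant N α δ (c n))
    (hδ : 0 < δ) :
    ∃ q ∈ feasible N δ, IsMinOn (modifiedObjective α δ c) (feasible N δ) q := by
  have hle : ∀ q ∈ feasible N δ, ∀ n, q.1 n ≤ δ := by
    intro q hq n
    have := Finset.single_le_sum (fun m _ => hq.2.1 m) (Finset.mem_univ n)
    have h1 := hq.1
    have h2 := hq.2.2
    linarith
  have hclosed : IsClosed (feasible N δ) := by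
    have h1 : IsClosed {q : (Fin N → ℝ) × ℝ | ∑ n, q.1 n = δ - q.2} :=
      isClosed_eq (by fun_prop) (by fun_prop)
    have h2 : IsClosed {q : (Fin N → ℝ) × ℝ | ∀ n, 0 ≤ q.1 n} := by
      rw [ofPred_forall]
      exact isClosed_iInter fun n => isClosed_le continuous_const (by fun_prop)
    have h3 : IsClosed {q : (Fin N → ℝ) × ℝ | 0 ≤ q.2} :=
      isClosed_le continuous_const (by fun_prop)
    exact h1.inter (h2.inter h3)
  have hcompact : IsCompact (feasible N δ) := by
    refine (isCompact_Icc (a := ((fun _ => 0, 0) : (Fin N → ℝ) × ℝ))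
      (b := (fun _ => δ, δ))).of_isClosed_subset hclosed ?_
    intro q hq
    refine ⟨⟨fun n => hq.2.1 n, hq.2.2⟩, ⟨fun n => hle q hq n, ?_⟩⟩
    have h1 := hq.1
    have := Finset.sum_nonneg fun m (_ : m ∈ Finset.univ) => hq.2.1 m
    change q.2 ≤ δ
    linarith
  have hne : (feasible N δ).Nonempty := ⟨(0, δ), by simp [feasible, hδ.le]⟩
  refine hcompact.exists_isMinOn hne (ContinuousOn.add ?_ (by fun_prop))
  refine continuousOn_finsetSum _ fun n _ => ?_
  exact ((hT n).continuousOn_modifiedCost hδ.le).comp (f := fun q : (Fin N → ℝ) × ℝ => q.1 n)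
    (by fun_prop) fun q hq => ⟨hq.2.1 n, hle q hq n⟩

/-- The term `δ - s n` is at most `∑ (δ - s m) = y + (N - 1)δ`, whereas the price contributes twice
that quantity, which is positive. -/
lemma denominator_pos (hN : 0 < N) (hα : 0 < α) (hδ : 0 < δ) {s : Fin N → ℝ} {y : ℝ}
    (hy : 0 < y) (hsum : ∑ n, s n = δ - y) (hs : ∀ n, 0 ≤ s n) (n : Fin N) :
    0 < price N α δ y - α / (2 * N) * (1 - s n / δ) := by
  have hN' : (1 : ℝ) ≤ N := by exact_mod_cast hN
  have hle : ∀ m, s m ≤ δ := fun m => by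
    have := Finset.single_le_sum (fun m _ => hs m) (Finset.mem_univ m)
    linarith
  have h1 := Finset.single_le_sum (f := fun m => δ - s m) (fun m _ => sub_nonneg.2 (hle m))
    (Finset.mem_univ n)
  rw [Finset.sum_sub_distrib, hsum] at h1
  simp only [Finset.sum_const, Finset.card_univ, Fintype.card_fin, nsmul_eq_mul] at h1
  have h2 : 0 ≤ ((N : ℝ) - 1) * δ := mul_nonneg (by linarith) hδ.le
  have h3 : price N α δ y - α / (2 * N) * (1 - s n / δ) =
      α / (2 * N * δ) * (2 * (y + ((N : ℝ) - 1) * δ) - (δ - s n)) := by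
    unfold price
    field_simp
  rw [h3]
  apply mul_pos (by positivity)
  linarith

lemma isKkt_of_isMinOn (hT : ∀ n, IsTenant N α δ (c n)) (hN : 0 < N) (hα : 0 < α) (hδ : 0 < δ)
    (hcheap : CheapOnSite α δ c) {s : Fin N → ℝ} {y : ℝ} (hf : (s, y) ∈ feasible N δ)
    (hmin : IsMinOn (modifiedObjective α δ c) (feasible N δ) (s, y)) : IsKkt α δ c s y := by
  have hN' : (1 : ℝ) ≤ N := by exact_mod_cast hN
  have hsum : ∑ n, s n = δ - y := hf.1
  have hs : ∀ n, 0 ≤ s n := hf.2.1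
  have hy0 : 0 ≤ y := hf.2.2
  have hleft := marginal_sub_le_of_isMinOn hT hN hδ hf hmin
  have hκ : 0 < α / (2 * N * δ) := by positivity
  have hy : 0 < y := by
    -- At `y = 0` the price is `α - α / N`. Cheap generation gives a tenant with marginal at least
    -- `α` halfway between `r` and `s n`, whereas minimality bounds it by `α - (3/4) α / N`.
    refine lt_of_le_of_ne hy0 fun hyz => ?_
    obtain ⟨n, r, hr, hrs, hα'⟩ := hcheap.exists_tenant (fun n => (hT n).toIsTenantCost)
      (s := s) (by linarith)
    have hsδ : s n ≤ δ := by
      have := Finset.single_le_sum (fun m _ => hs m) (Finset.mem_univ n)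
      linarith
    have h1 := hleft n ((s n - r) / 2) (by linarith) (by linarith)
    have h2 := (hT n).rightDeriv_le_marginal (z := s n - (s n - r) / 2) (by linarith)
    have h3 := (hT n).rightDeriv_mul_le (s n - (s n - r) / 2) r
    have h4 := hα' (s n - (s n - r) / 2) (by linarith)
    have h5 : α ≤ rightDeriv (c n) (s n - (s n - r) / 2) := by
      have : α * ((s n - r) / 2) ≤ rightDeriv (c n) (s n - (s n - r) / 2) * ((s n - r) / 2) := by
        linarith
      exact le_of_mul_le_mul_right this (by linarith)
    have h6 : α / (2 * N * δ) * ((s n - r) / 2) ≤ α / (2 * N * δ) * (δ / 2) := by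
      gcongr
      linarith
    have h7 : price N α δ y + α / (2 * N * δ) * (δ / 2) = α - 3 / 4 * (α / N) := by
      rw [← hyz]
      unfold price
      field_simp
      ring
    have h8 : 0 < α / N := by positivity
    linarith
  have hprice : α / (2 * N) ≤ price N α δ y := by
    -- A price below `a` would force `y < δ`, so some tenant supplies. Its marginal just below `s n`
    -- is at least `a`, yet minimality keeps it within `κ e` of the price; `e` is chosen so that `κ
    -- e` is at most half the gap `d`.
    by_contra! hlt
    have hyδ : y < δ := by
      by_contra! hyδ
      refine absurd hlt (not_lt.2 ?_)
      have h1 : price N α δ y - α / (2 * N) =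
          α / (2 * N * δ) * (2 * (y + ((N : ℝ) - 1) * δ) - δ) := by
        unfold price
        field_simp
      have h2 : 0 ≤ ((N : ℝ) - 1) * δ := mul_nonneg (by linarith) hδ.le
      have h3 : 0 ≤ α / (2 * N * δ) * (2 * (y + ((N : ℝ) - 1) * δ) - δ) :=
        mul_nonneg hκ.le (by linarith)
      linarith
    have hex : ∃ n ∈ Finset.univ, (0 : ℝ) < s n :=
      Finset.exists_lt_of_sum_lt (f := fun _ => (0 : ℝ)) (by simp [hsum, hyδ])
    obtain ⟨n, -, hn⟩ := hex
    set d := α / (2 * N) - price N α δ y with hd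
    have hd0 : 0 < d := by linarith
    set e := min (s n) (d / (2 * (α / (2 * N * δ)))) with he
    have he0 : 0 < e := lt_min hn (by positivity)
    have h1 := hleft n e he0 (min_le_left _ _)
    have hpos : 0 ≤ s n - e := by linarith [min_le_left (s n) (d / (2 * (α / (2 * N * δ))))]
    have h2 := (hT n).rightDeriv_le_marginal hpos
    have h3 := (hT n).le_rightDeriv hpos
    have h4 : α / (2 * N * δ) * e ≤ α / (2 * N * δ) * (d / (2 * (α / (2 * N * δ)))) :=
      mul_le_mul_of_nonneg_left (min_le_right _ _) hκ.le
    have h5 : α / (2 * N * δ) * (d / (2 * (α / (2 * N * δ)))) = d / 2 := by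
      field_simp
    linarith
  refine ⟨hy, hsum, hs, hprice, fun n => ?_⟩
  have hD := denominator_pos hN hα hδ hy hsum hs n
  have ha := (hT n).share_pos
  set p := price N α δ y with hp
  have hg : (p * (p - α / (2 * N)) / (p - α / (2 * N) * (1 - s n / δ))) *
      (p - α / (2 * N) * (1 - s n / δ)) = p * (p - α / (2 * N)) := div_mul_cancel₀ _ hD.ne'
  refine ⟨_, hg, fun w => ?_⟩
  rcases lt_trichotomy w (s n) with hw | hw | hw
  · rcases (hs n).eq_or_lt with h0 | h0
    · have h1 : c n w = 0 := (hT n).zero_of_nonpos w (by linarith)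
      have h2 : c n (s n) = 0 := (hT n).zero_of_nonpos _ h0.ge
      rw [h1, h2, sub_zero]
      refine mul_nonpos_of_nonneg_of_nonpos (div_nonneg (mul_nonneg ?_ ?_) hD.le) ?_ <;> linarith
    · exact (hT n).subgradient_left h0 hprice hκ.le hD hg (hleft n) hw
  · simp [hw]
  · exact (hT n).subgradient_right (hs n) hprice hD hg hy
      (le_marginal_add_of_isMinOn hT hN hδ hf hmin n) hw

end Market

/-! ### One tenant's best response in the variable `σ`. -/

section BestResponse

variable {c : ℝ → ℝ} {δ k A σ₀ g : ℝ}

/-- The payoff of a tenant as a function of the square root `σ` of the sum of all bids, when the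
other bids sum to `A` and `k ^ 2 = N δ / α`. -/
noncomputable def reducedPayoff (c : ℝ → ℝ) (δ k A σ : ℝ) : ℝ :=
  σ * (δ / k) - (σ ^ 2 - A) - c (δ - k * (σ - A / σ))

/-- After the subgradient inequality, the payoff difference is at most `-(σ - σ₀)² (1 + g k A / (σ
σ₀²))`. The case `A = 0` is separate because it allows `σ = 0`. -/
lemma reducedPayoff_le (hk : 0 < k) (hA : 0 ≤ A) (hσ₀ : 0 < σ₀) (hg : 0 ≤ g)
    (hfoc : g * k * (1 + A / σ₀ ^ 2) = 2 * σ₀ - δ / k)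
    (hsub : ∀ w, g * (w - (δ - k * (σ₀ - A / σ₀))) ≤ c w - c (δ - k * (σ₀ - A / σ₀)))
    {σ : ℝ} (hσ : 0 ≤ σ) (hAσ : A ≤ σ ^ 2) :
    reducedPayoff c δ k A σ ≤ reducedPayoff c δ k A σ₀ := by
  have h1 := hsub (δ - k * (σ - A / σ))
  have key : (σ - σ₀) * (δ / k) - (σ ^ 2 - σ₀ ^ 2) +
      g * k * ((σ - A / σ) - (σ₀ - A / σ₀)) ≤ 0 := by
    rw [show δ / k = 2 * σ₀ - g * k * (1 + A / σ₀ ^ 2) by linarith]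
    rcases hA.eq_or_lt with rfl | hA
    · simp only [zero_div]
      nlinarith [sq_nonneg (σ - σ₀)]
    · have hσ : 0 < σ := by
        rcases hσ.eq_or_lt with rfl | h
        · norm_num at hAσ; linarith
        · exact h
      have : (σ - σ₀) * (2 * σ₀ - g * k * (1 + A / σ₀ ^ 2)) - (σ ^ 2 - σ₀ ^ 2) +
          g * k * ((σ - A / σ) - (σ₀ - A / σ₀)) =
          -((σ - σ₀) ^ 2 * (1 + g * k * (A / (σ * σ₀ ^ 2)))) := by
        field_simp
        ring
      rw [this]
      have : 0 ≤ (σ - σ₀) ^ 2 * (1 + g * k * (A / (σ * σ₀ ^ 2))) := by positivity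
      linarith
  unfold reducedPayoff
  linarith

/-- Raising the bid (`σ > σ₀`) lowers the supply to some `z < s`. Optimality bounds the secant slope
on `[z, s]`, convexity transfers the bound to `[w, s]`, and `σ → σ₀` gives the claim. -/
lemma subgradient_left_of_reducedPayoff_le (hc : ConvexOn ℝ univ c) (hk : 0 < k) (hA : 0 ≤ A)
    (hσ₀ : 0 < σ₀) (hAσ₀ : A ≤ σ₀ ^ 2) (hfoc : g * k * (1 + A / σ₀ ^ 2) = 2 * σ₀ - δ / k)
    (hmax : ∀ σ, 0 ≤ σ → A ≤ σ ^ 2 → reducedPayoff c δ k A σ ≤ reducedPayoff c δ k A σ₀)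
    {w : ℝ} (hw : w < δ - k * (σ₀ - A / σ₀)) :
    g * (w - (δ - k * (σ₀ - A / σ₀))) ≤ c w - c (δ - k * (σ₀ - A / σ₀)) := by
  set s := δ - k * (σ₀ - A / σ₀) with hs
  have cont : ContinuousAt (fun σ => δ - k * (σ - A / σ)) σ₀ := by
    have := hσ₀.ne'
    fun_prop (disch := assumption)
  have h1 : (c s - c w) * (k * (1 + A / (σ₀ * σ₀))) ≤ (σ₀ + σ₀ - δ / k) * (s - w) := by
    refine le_of_tendsto_of_tendsto (b := 𝓝[>] σ₀)
      (f := fun σ => (c s - c w) * (k * (1 + A / (σ * σ₀))))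
      (g := fun σ => (σ + σ₀ - δ / k) * (s - w)) ?_ ?_ ?_
    · refine (ContinuousAt.tendsto ?_).mono_left nhdsWithin_le_nhds
      have : σ₀ * σ₀ ≠ 0 := by positivity
      fun_prop (disch := assumption)
    · exact (Continuous.tendsto (by fun_prop) σ₀).mono_left nhdsWithin_le_nhds
    · have hev : ∀ᶠ σ in 𝓝[>] σ₀, w < δ - k * (σ - A / σ) :=
        (cont.tendsto.mono_left nhdsWithin_le_nhds).eventually_const_lt hw
      filter_upwards [hev, self_mem_nhdsWithin] with σ hwz hσ
      have hσ : σ₀ < σ := hσ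
      have hσ0 : 0 < σ := hσ₀.trans hσ
      have hdiff : s - (δ - k * (σ - A / σ)) = (σ - σ₀) * (k * (1 + A / (σ * σ₀))) := by
        rw [hs]
        field_simp
        ring
      have hpos : 0 < (σ - σ₀) * (k * (1 + A / (σ * σ₀))) := by
        have : 0 < σ - σ₀ := sub_pos.2 hσ
        positivity
      have h2 := hmax σ hσ0.le (hAσ₀.trans (by gcongr))
      have h3 := hc.secant_mono_aux1 (mem_univ w) (mem_univ s) hwz (by linarith)
      unfold reducedPayoff at h2
      rw [← hs] at h2
      set z := δ - k * (σ - A / σ) with hz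
      have h4 : (σ - σ₀) * ((c s - c w) * (k * (1 + A / (σ * σ₀)))) ≤
          (σ - σ₀) * ((σ + σ₀ - δ / k) * (s - w)) := by
        calc _ = (s - z) * (c s - c w) := by rw [hdiff]; ring
          _ ≤ (s - w) * (c s - c z) := by linarith
          _ ≤ (s - w) * ((σ - σ₀) * (σ + σ₀ - δ / k)) :=
            mul_le_mul_of_nonneg_left (by linarith) (by linarith)
          _ = _ := by ring
      exact le_of_mul_le_mul_left h4 (sub_pos.2 hσ)
  have h2 : (c s - c w) * (k * (1 + A / (σ₀ * σ₀))) ≤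
      (g * (s - w)) * (k * (1 + A / (σ₀ * σ₀))) := by
    rw [← two_mul, ← hfoc, pow_two] at h1
    linarith
  have := le_of_mul_le_mul_right h2 (by positivity)
  linarith

/-- The mirror argument lowers the bid, which is possible only for a positive bid; hence the strict
`A < σ₀ ^ 2`. -/
lemma subgradient_right_of_reducedPayoff_le (hc : ConvexOn ℝ univ c) (hk : 0 < k) (hA : 0 ≤ A)
    (hσ₀ : 0 < σ₀) (hAσ₀ : A < σ₀ ^ 2) (hfoc : g * k * (1 + A / σ₀ ^ 2) = 2 * σ₀ - δ / k)
    (hmax : ∀ σ, 0 ≤ σ → A ≤ σ ^ 2 → reducedPayoff c δ k A σ ≤ reducedPayoff c δ k A σ₀)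
    {w : ℝ} (hw : δ - k * (σ₀ - A / σ₀) < w) :
    g * (w - (δ - k * (σ₀ - A / σ₀))) ≤ c w - c (δ - k * (σ₀ - A / σ₀)) := by
  set s := δ - k * (σ₀ - A / σ₀) with hs
  have cont : ContinuousAt (fun σ => δ - k * (σ - A / σ)) σ₀ := by
    have := hσ₀.ne'
    fun_prop (disch := assumption)
  have h1 : (σ₀ + σ₀ - δ / k) * (w - s) ≤ (c w - c s) * (k * (1 + A / (σ₀ * σ₀))) := by
    refine le_of_tendsto_of_tendsto (b := 𝓝[<] σ₀)
      (g := fun σ => (c w - c s) * (k * (1 + A / (σ * σ₀))))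
      (f := fun σ => (σ + σ₀ - δ / k) * (w - s)) ?_ ?_ ?_
    · exact (Continuous.tendsto (by fun_prop) σ₀).mono_left nhdsWithin_le_nhds
    · refine (ContinuousAt.tendsto ?_).mono_left nhdsWithin_le_nhds
      have : σ₀ * σ₀ ≠ 0 := by positivity
      fun_prop (disch := assumption)
    · have hev : ∀ᶠ σ in 𝓝[<] σ₀, δ - k * (σ - A / σ) < w :=
        (cont.tendsto.mono_left nhdsWithin_le_nhds).eventually_lt_const hw
      have hev2 : ∀ᶠ σ in 𝓝[<] σ₀, A < σ ^ 2 :=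
        ((Continuous.tendsto (by fun_prop) σ₀).mono_left
          nhdsWithin_le_nhds).eventually_const_lt hAσ₀
      filter_upwards [hev, hev2, Ioo_mem_nhdsLT hσ₀] with σ hwz hAσ hσ'
      have hσ : σ < σ₀ := hσ'.2
      have hσ0 : 0 < σ := hσ'.1
      have hdiff : (δ - k * (σ - A / σ)) - s = (σ₀ - σ) * (k * (1 + A / (σ * σ₀))) := by
        rw [hs]
        field_simp
        ring
      have hpos : 0 < (σ₀ - σ) * (k * (1 + A / (σ * σ₀))) := by
        have : 0 < σ₀ - σ := sub_pos.2 hσ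
        positivity
      have h2 := hmax σ hσ0.le hAσ.le
      have h3 := hc.secant_mono_aux1 (mem_univ s) (mem_univ w) (by linarith) hwz
      unfold reducedPayoff at h2
      rw [← hs] at h2
      set z := δ - k * (σ - A / σ) with hz
      have h4 : (σ₀ - σ) * ((σ + σ₀ - δ / k) * (w - s)) ≤
          (σ₀ - σ) * ((c w - c s) * (k * (1 + A / (σ * σ₀)))) := by
        calc _ = (w - s) * ((σ₀ - σ) * (σ + σ₀ - δ / k)) := by ring
          _ ≤ (w - s) * (c z - c s) :=
            mul_le_mul_of_nonneg_left (by linarith) (by linarith)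
          _ ≤ (z - s) * (c w - c s) := by linarith
          _ = _ := by rw [hdiff]; ring
      exact le_of_mul_le_mul_left h4 (sub_pos.2 hσ)
  have h2 : (g * (w - s)) * (k * (1 + A / (σ₀ * σ₀))) ≤
      (c w - c s) * (k * (1 + A / (σ₀ * σ₀))) := by
    rw [← two_mul, ← hfoc, pow_two] at h1
    linarith
  exact le_of_mul_le_mul_right h2 (by positivity)

end BestResponse

/-! ### Equilibria and the first order conditions. -/

section Equilibrium

variable {N : ℕ} {α δ k : ℝ} {c : Fin N → ℝ → ℝ}

lemma eq_of_sq_eq (hN : 0 < N) (hδ : 0 < δ) (hα : 0 < α)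
    (hk2 : k ^ 2 = N * δ / α) : α = N * δ / k ^ 2 := by
  have hN' : (0 : ℝ) < N := by exact_mod_cast hN
  rw [hk2]
  field_simp

lemma payoff_update_eq (hN : 0 < N) (hα : 0 < α) (hδ : 0 < δ) (hk : 0 < k)
    (hk2 : k ^ 2 = N * δ / α) (b : Fin N → ℝ) (n : Fin N) {A σ : ℝ} (hA : A = ∑ i, b i - b n)
    (hσ : 0 ≤ σ) :
    payoff α δ c n (Function.update b n (σ ^ 2 - A)) = reducedPayoff (c n) δ k A σ := by
  have hN' : (0 : ℝ) < N := by exact_mod_cast hN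
  have hsum : ∑ i, Function.update b n (σ ^ 2 - A) i = σ ^ 2 := by
    have := sum_apply_update (fun _ z => z) b n (σ ^ 2 - A)
    linarith
  have h1 : √(N * δ / α) = k := by rw [← hk2, Real.sqrt_sq hk.le]
  have h2 : σ ^ 2 * α * δ / N = (σ * (δ / k)) ^ 2 := by
    rw [eq_of_sq_eq hN hδ hα hk2]
    field_simp
  -- At `σ = 0` both sides are `0` by the division convention, in agreement with `0 / 0 = 0` in the
  -- payoff.
  have h3 : (σ ^ 2 - A) / σ = σ - A / σ := by
    rcases hσ.eq_or_lt with rfl | h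
    · simp
    · field_simp
  unfold payoff reducedPayoff
  rw [hsum, h1, h2, Real.sqrt_sq (by positivity), Real.sqrt_sq hσ, Function.update_self, h3,
    mul_comm k]

/-- Completing the square in `T = (N - 1)δ + y` isolates a term `(T - kσ)² / T`, so the minimum over
`T > 0` is exactly at `T = kσ`. -/
lemma operatorCost_eq (hN : 0 < N) (hα : 0 < α)
    (hk2 : k ^ 2 = N * δ / α) {b : Fin N → ℝ} {σ : ℝ} (hσ : ∑ i, b i = σ ^ 2) {y : ℝ}
    (hy : 0 < ((N : ℝ) - 1) * δ + y) :
    operatorCost α δ b y = α * ((((N : ℝ) - 1) * δ + y - k * σ) ^ 2 / (((N : ℝ) - 1) * δ + y)) +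
      (2 * α * (k * σ) - σ ^ 2 - α * (((N : ℝ) - 1) * δ)) := by
  have hN' : (0 : ℝ) < N := by exact_mod_cast hN
  unfold operatorCost clearingPrice
  rw [hσ]
  obtain ⟨T, hT⟩ : ∃ T, T = ((N : ℝ) - 1) * δ + y := ⟨_, rfl⟩
  rw [← hT] at hy ⊢
  have hy' : y = T - ((N : ℝ) - 1) * δ := by linarith
  have h2 : α * k ^ 2 = N * δ := by rw [hk2]; field_simp
  rw [hy']
  field_simp
  linear_combination -σ ^ 2 * h2

/-- The two forms differ by the factor `σ / (2 k²)`, since `a = δ / (2 k²)`. -/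
lemma foc_iff (hN : 0 < N) (hα : 0 < α) (hδ : 0 < δ) (hk : 0 < k)
    (hk2 : k ^ 2 = N * δ / α) {σ b g : ℝ} (hσ : 0 < σ) :
    g * k * (1 + (σ ^ 2 - b) / σ ^ 2) = 2 * σ - δ / k ↔
    g * (σ / k - α / (2 * N) * (1 - supply δ b (σ / k) / δ)) =
      σ / k * (σ / k - α / (2 * N)) := by
  have hN' : (0 : ℝ) < N := by exact_mod_cast hN
  have h1 : α / (2 * N) = δ / (2 * k ^ 2) := by
    rw [eq_of_sq_eq hN hδ hα hk2]
    field_simp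
  have e1 : g * (σ / k - δ / (2 * k ^ 2) * (1 - supply δ b (σ / k) / δ)) =
      σ / (2 * k ^ 2) * (g * k * (1 + (σ ^ 2 - b) / σ ^ 2)) := by
    unfold supply
    field_simp
    ring
  have e2 : σ / k * (σ / k - δ / (2 * k ^ 2)) = σ / (2 * k ^ 2) * (2 * σ - δ / k) := by
    field_simp
  rw [h1, e1, e2]
  exact (mul_right_inj' (by positivity)).symm

lemma price_eq_div (hN : 0 < N) (hα : 0 < α) (hδ : 0 < δ) (hk : 0 < k)
    (hk2 : k ^ 2 = N * δ / α) {σ y : ℝ} (h : y + ((N : ℝ) - 1) * δ = k * σ) :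
    price N α δ y = σ / k := by
  have hN' : (0 : ℝ) < N := by exact_mod_cast hN
  unfold price
  rw [h, eq_of_sq_eq hN hδ hα hk2]
  field_simp

lemma supply_eq {σ b : ℝ} (hσ : 0 < σ) :
    δ - k * (σ - (σ ^ 2 - b) / σ) = supply δ b (σ / k) := by
  unfold supply
  field_simp
  ring

/-- The bids `p (δ - s n)` invert the supply function at `p = σ / k`, and they sum to `σ²` by the
balance constraint. -/
lemma IsKkt.exists_isEquilibrium (hT : ∀ n, IsTenant N α δ (c n)) (hN : 0 < N) (hα : 0 < α)
    (hδ : 0 < δ) {s : Fin N → ℝ} {y : ℝ} (h : IsKkt α δ c s y) :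
    ∃ b : Fin N → ℝ, ∃ p, IsEquilibrium α δ c b p y := by
  have hN' : (1 : ℝ) ≤ N := by exact_mod_cast hN
  obtain ⟨k, hk, hk2⟩ : ∃ k : ℝ, 0 < k ∧ k ^ 2 = N * δ / α :=
    ⟨√(N * δ / α), by positivity, Real.sq_sqrt (by positivity)⟩
  have hy := h.generation_pos
  have hT0 : 0 < y + ((N : ℝ) - 1) * δ :=
    add_pos_of_pos_of_nonneg hy (mul_nonneg (by linarith) hδ.le)
  obtain ⟨σ, hσ⟩ : ∃ σ, σ = (y + ((N : ℝ) - 1) * δ) / k := ⟨_, rfl⟩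
  have hσ0 : 0 < σ := hσ ▸ div_pos hT0 hk
  have hkσ : y + ((N : ℝ) - 1) * δ = k * σ := by rw [hσ]; field_simp
  have hp := price_eq_div hN hα hδ hk hk2 hkσ
  have hsδ : ∀ n, s n ≤ δ := fun n => by
    have := Finset.single_le_sum (fun m _ => h.nonneg m) (Finset.mem_univ n)
    linarith [h.sum_eq]
  have hb : ∀ n, 0 ≤ σ / k * (δ - s n) := fun n =>
    mul_nonneg (by positivity) (sub_nonneg.2 (hsδ n))
  have hsum : ∑ n, σ / k * (δ - s n) = σ ^ 2 := by
    rw [← Finset.mul_sum, Finset.sum_sub_distrib, h.sum_eq]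
    simp only [Finset.sum_const, Finset.card_univ, Fintype.card_fin, nsmul_eq_mul]
    rw [show N * δ - (δ - y) = k * σ by linarith]
    field_simp
  refine ⟨fun n => σ / k * (δ - s n), σ / k, hb, fun n b' hb' => ?_, ?_, ?_, ?_⟩
  · have hle : σ / k * (δ - s n) ≤ σ ^ 2 := by
      rw [← hsum]
      exact Finset.single_le_sum (f := fun n => σ / k * (δ - s n)) (fun m _ => hb m)
        (Finset.mem_univ n)
    have hsupply : supply δ (σ / k * (δ - s n)) (σ / k) = s n := by
      unfold supply
      field_simp
      ring
    obtain ⟨A, hA⟩ : ∃ A, A = σ ^ 2 - σ / k * (δ - s n) := ⟨_, rfl⟩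
    have hA0 : 0 ≤ A := by linarith
    have hA' : A = ∑ m, σ / k * (δ - s m) - σ / k * (δ - s n) := by rw [hsum, hA]
    obtain ⟨g, hg, hsub⟩ := h.subgradient n
    rw [hp, ← hsupply, ← foc_iff hN hα hδ hk hk2 hσ0, ← hA] at hg
    have hg0 : 0 ≤ g := by
      have h1 := hsub (s n - 1)
      have h2 := (hT n).monotone (show s n - 1 ≤ s n by linarith)
      linarith
    rw [← hsupply, ← supply_eq hσ0, ← hA] at hsub
    have hsq : √(A + b') ^ 2 = A + b' := Real.sq_sqrt (by linarith)
    have key := reducedPayoff_le hk hA0 hσ0 hg0 hg hsub (Real.sqrt_nonneg (A + b'))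
      (by rw [hsq]; linarith)
    rw [← payoff_update_eq hN hα hδ hk hk2 (fun n => σ / k * (δ - s n)) n hA' hσ0.le,
      ← payoff_update_eq hN hα hδ hk hk2 (fun n => σ / k * (δ - s n)) n hA'
        (Real.sqrt_nonneg (A + b')), hsq, add_sub_cancel_left,
      show σ ^ 2 - A = σ / k * (δ - s n) by linarith] at key
    rwa [Function.update_eq_self] at key
  · unfold clearingPrice
    rw [hsum, add_comm, hkσ]
    field_simp
  · have h0 := Finset.sum_nonneg fun m (_ : m ∈ Finset.univ) => h.nonneg m
    exact ⟨hy.le, by linarith [h.sum_eq], by linarith⟩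
  · intro y' hy'
    have hy' : 0 < ((N : ℝ) - 1) * δ + y' := hy'.2.2
    change operatorCost _ _ _ _ ≤ operatorCost _ _ _ _
    rw [operatorCost_eq hN hα hk2 hsum hy',
      operatorCost_eq hN hα hk2 hsum (by linarith), add_comm _ y, hkσ, sub_self]
    have : 0 ≤ α * ((((N : ℝ) - 1) * δ + y' - k * σ) ^ 2 / (((N : ℝ) - 1) * δ + y')) := by
      positivity
    simp only [ne_eq, OfNat.ofNat_ne_zero, not_false_eq_true, zero_pow, zero_div, mul_zero]
    linarith

lemma IsEquilibrium.sum_pos (hT : ∀ n, IsTenant N α δ (c n)) (hN : 0 < N) (hα : 0 < α)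
    (hδ : 0 < δ) {b : Fin N → ℝ} {p y : ℝ} (e : IsEquilibrium α δ c b p y) : 0 < ∑ i, b i := by
  have hN' : (0 : ℝ) < N := by exact_mod_cast hN
  obtain ⟨k, hk, hk2⟩ : ∃ k : ℝ, 0 < k ∧ k ^ 2 = N * δ / α :=
    ⟨√(N * δ / α), by positivity, Real.sq_sqrt (by positivity)⟩
  refine (Finset.sum_nonneg fun i _ => e.bid_nonneg i).lt_of_ne' fun h0 => ?_
  have hb := (Finset.sum_eq_zero_iff_of_nonneg fun i _ => e.bid_nonneg i).1 h0
  let n : Fin N := ⟨0, hN⟩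
  have hbn : b n = 0 := hb n (Finset.mem_univ n)
  have hA : (0 : ℝ) = ∑ i, b i - b n := by rw [h0, hbn, sub_zero]
  have h1 := payoff_update_eq (c := c) hN hα hδ hk hk2 b n hA le_rfl
  -- If all bids vanish, `σ = δ / (2k)` maximizes `σ δ / k - σ²`. Deviating to it gains `(δ /
  -- (2k))²` and does not raise the tenant's cost.
  have h2 := payoff_update_eq (c := c) hN hα hδ hk hk2 b n hA
    (show 0 ≤ δ / (2 * k) by positivity)
  have h3 := e.payoff_max n ((δ / (2 * k)) ^ 2 - 0) (by rw [sub_zero]; positivity)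
  rw [show (0 : ℝ) ^ 2 - 0 = b n by rw [hbn]; norm_num, Function.update_eq_self] at h1
  rw [h1, h2] at h3
  have h4 := (hT n).monotone (show δ - k * (δ / (2 * k) - 0 / (δ / (2 * k))) ≤
    δ - k * (0 - 0 / 0) by
      have : 0 ≤ k * (δ / (2 * k)) := by positivity
      simp only [zero_div, sub_zero, mul_zero]
      linarith)
  unfold reducedPayoff at h3
  have h5 : δ / (2 * k) * (δ / k) - ((δ / (2 * k)) ^ 2 - 0) = (δ / (2 * k)) ^ 2 := by
    field_simp
    ring
  have h6 : 0 < (δ / (2 * k)) ^ 2 := by positivity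
  linarith

/-- Best responses give subgradients satisfying the first order condition at the price `σ / k`. This
price is the market price only once the unconstrained optimum `kσ - (N - 1)δ` is known to be
admissible, which needs nonnegative supplies and cheap generation. -/
lemma IsEquilibrium.isKkt (hT : ∀ n, IsTenant N α δ (c n)) (hN : 0 < N) (hα : 0 < α)
    (hδ : 0 < δ) (hcheap : CheapOnSite α δ c) {b : Fin N → ℝ} {p y : ℝ}
    (e : IsEquilibrium α δ c b p y) :
    p = price N α δ y ∧ IsKkt α δ c (fun n => supply δ (b n) p) y := by
  have hN' : (1 : ℝ) ≤ N := by exact_mod_cast hN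
  obtain ⟨k, hk, hk2⟩ : ∃ k : ℝ, 0 < k ∧ k ^ 2 = N * δ / α :=
    ⟨√(N * δ / α), by positivity, Real.sq_sqrt (by positivity)⟩
  have hαk := eq_of_sq_eq hN hδ hα hk2
  have hB := e.sum_pos hT hN hα hδ
  obtain ⟨σ, hσ0, hσ⟩ : ∃ σ : ℝ, 0 < σ ∧ ∑ i, b i = σ ^ 2 :=
    ⟨√(∑ i, b i), Real.sqrt_pos.2 hB, (Real.sq_sqrt hB.le).symm⟩
  have hbσ : ∀ n, b n ≤ σ ^ 2 := fun n => by
    rw [← hσ]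
    exact Finset.single_le_sum (fun i _ => e.bid_nonneg i) (Finset.mem_univ n)
  have hmax : ∀ n, ∀ τ : ℝ, 0 ≤ τ → σ ^ 2 - b n ≤ τ ^ 2 →
      reducedPayoff (c n) δ k (σ ^ 2 - b n) τ ≤ reducedPayoff (c n) δ k (σ ^ 2 - b n) σ := by
    intro n τ hτ hAτ
    have hA : σ ^ 2 - b n = ∑ i, b i - b n := by rw [hσ]
    rw [← payoff_update_eq hN hα hδ hk hk2 b n hA hτ,
      ← payoff_update_eq hN hα hδ hk hk2 b n hA hσ0.le,
      sub_sub_cancel, Function.update_eq_self]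
    exact e.payoff_max n _ (by linarith)
  have hden : ∀ n, 0 < k * (1 + (σ ^ 2 - b n) / σ ^ 2) := fun n => by
    have := sub_nonneg.2 (hbσ n)
    positivity
  have hfoc : ∀ n, ∃ g, g * k * (1 + (σ ^ 2 - b n) / σ ^ 2) = 2 * σ - δ / k := fun n =>
    ⟨(2 * σ - δ / k) / (k * (1 + (σ ^ 2 - b n) / σ ^ 2)), by
      rw [mul_assoc, div_mul_cancel₀ _ (hden n).ne']⟩
  choose g hfoc using hfoc
  have hleft : ∀ n, ∀ w, w < supply δ (b n) (σ / k) →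
      g n * (w - supply δ (b n) (σ / k)) ≤ c n w - c n (supply δ (b n) (σ / k)) := by
    intro n w hw
    rw [← supply_eq hσ0] at hw ⊢
    exact subgradient_left_of_reducedPayoff_le (hT n).convexOn_univ hk (sub_nonneg.2 (hbσ n)) hσ0
      (by linarith [e.bid_nonneg n]) (hfoc n) (hmax n) hw
  have hright : ∀ n, 0 < b n → ∀ w, supply δ (b n) (σ / k) < w →
      g n * (w - supply δ (b n) (σ / k)) ≤ c n w - c n (supply δ (b n) (σ / k)) := by
    intro n hbn w hw
    rw [← supply_eq hσ0] at hw ⊢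
    exact subgradient_right_of_reducedPayoff_le (hT n).convexOn_univ hk (sub_nonneg.2 (hbσ n)) hσ0
      (by linarith) (hfoc n) (hmax n) hw
  have hg0 : ∀ n, 0 ≤ g n := fun n => by
    have h1 := hleft n (supply δ (b n) (σ / k) - 1) (by linarith)
    have h2 := (hT n).monotone
      (show supply δ (b n) (σ / k) - 1 ≤ supply δ (b n) (σ / k) by linarith)
    linarith
  have hσk : 0 ≤ 2 * σ - δ / k := by
    rw [← hfoc ⟨0, hN⟩, mul_assoc]
    exact mul_nonneg (hg0 _) (hden _).le
  have hshare : α / (2 * N) = δ / (2 * k ^ 2) := by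
    rw [hαk]
    field_simp
  have hprice : α / (2 * N) ≤ σ / k := by
    rw [hshare]
    have : σ / k - δ / (2 * k ^ 2) = (2 * σ - δ / k) / (2 * k) := by field_simp
    have : 0 ≤ (2 * σ - δ / k) / (2 * k) := by positivity
    linarith
  have hs0 : ∀ n, 0 ≤ supply δ (b n) (σ / k) := by
    intro n
    -- At a negative supply the cost is flat, so `g n = 0` and the first order condition gives `kσ =
    -- δ / 2`. But `b n ≤ σ²` makes the supply at least `δ - kσ`, which is then positive.
    by_contra! hneg
    have hbn : 0 < b n := by
      refine (e.bid_nonneg n).lt_of_ne fun h0 => ?_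
      rw [← h0, supply, zero_div, sub_zero] at hneg
      linarith
    have h1 := hright n hbn 0 hneg
    rw [(hT n).zero_of_nonpos 0 le_rfl, (hT n).zero_of_nonpos _ hneg.le] at h1
    have h2 : g n = 0 := le_antisymm (by nlinarith) (hg0 n)
    have h3 := hfoc n
    rw [h2, zero_mul, zero_mul] at h3
    have h4 : supply δ (b n) (σ / k) ≥ δ - k * σ := by
      have : b n / (σ / k) ≤ σ ^ 2 / (σ / k) := by
        gcongr
        exact hbσ n
      have h5 : σ ^ 2 / (σ / k) = k * σ := by field_simp
      unfold supply
      linarith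
    have h5 : k * σ = δ / 2 := by
      rw [show σ = δ / k / 2 by linarith]
      field_simp
    linarith
  have hsum : ∑ n, supply δ (b n) (σ / k) = N * δ - k * σ := by
    unfold supply
    rw [Finset.sum_sub_distrib, ← Finset.sum_div, hσ]
    simp only [Finset.sum_const, Finset.card_univ, Fintype.card_fin, nsmul_eq_mul]
    congr 1
    field_simp
  have hy0 : 0 < k * σ - ((N : ℝ) - 1) * δ := by
    -- Otherwise the supplies sum to at least `δ`, and cheap generation gives a tenant with `g n ≥
    -- α`. The first order condition then forces `σ / k > α`, that is `kσ > Nδ`, contradicting `kσ ≤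
    -- (N - 1)δ`.
    by_contra! hneg
    obtain ⟨n, r, hr, hrs, hα'⟩ := hcheap.exists_tenant (fun n => (hT n).toIsTenantCost)
      (s := fun n => supply δ (b n) (σ / k)) (by linarith)
    have h1 := hleft n r hrs
    have h2 := hα' _ hrs.le
    have h3 : α ≤ g n := by
      have : α * (supply δ (b n) (σ / k) - r) ≤ g n * (supply δ (b n) (σ / k) - r) := by linarith
      exact le_of_mul_le_mul_right this (by linarith)
    have h4 := (foc_iff hN hα hδ hk hk2 hσ0).1 (hfoc n)
    have ha := (hT n).share_pos
    have h5 : 0 < α / (2 * N) * (supply δ (b n) (σ / k) / δ) :=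
      mul_pos ha (div_pos (by linarith) hδ)
    have h6 : α * (σ / k - α / (2 * N) * (1 - supply δ (b n) (σ / k) / δ)) ≤
        g n * (σ / k - α / (2 * N) * (1 - supply δ (b n) (σ / k) / δ)) :=
      mul_le_mul_of_nonneg_right h3 (by linarith)
    have h7 : α * (σ / k - α / (2 * N)) < σ / k * (σ / k - α / (2 * N)) := by
      have := mul_pos hα h5
      linarith
    have h8 : α < σ / k := lt_of_mul_lt_mul_right h7 (by linarith)
    rw [hαk, lt_div_iff₀ hk] at h8
    have h9 : N * δ / k ^ 2 * k * k = N * δ := by field_simp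
    have h10 : N * δ / k ^ 2 * k * k < σ * k := by gcongr
    linarith
  have hmem : k * σ - ((N : ℝ) - 1) * δ ∈ generationLevels N δ := by
    refine ⟨hy0.le, ?_, by rw [add_sub_cancel]; positivity⟩
    have := Finset.sum_nonneg fun n (_ : n ∈ Finset.univ) => hs0 n
    linarith
  have hyeq : y + ((N : ℝ) - 1) * δ = k * σ := by
    have hpos := e.generation_mem.2.2
    have h1 : operatorCost α δ b y ≤ operatorCost α δ b (k * σ - ((N : ℝ) - 1) * δ) :=
      e.generation_min hmem
    rw [operatorCost_eq hN hα hk2 hσ hpos, operatorCost_eq hN hα hk2 hσ hmem.2.2,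
      add_sub_cancel, sub_self] at h1
    simp only [ne_eq, OfNat.ofNat_ne_zero, not_false_eq_true, zero_pow, zero_div, mul_zero] at h1
    have h2 : (((N : ℝ) - 1) * δ + y - k * σ) ^ 2 / (((N : ℝ) - 1) * δ + y) ≤ 0 :=
      le_of_mul_le_mul_left (by linarith) hα
    rw [div_le_iff₀ hpos, zero_mul] at h2
    have h3 := pow_eq_zero_iff (two_ne_zero) |>.1 (le_antisymm h2 (sq_nonneg _))
    linarith
  have hp' := price_eq_div hN hα hδ hk hk2 hyeq
  have hp : p = σ / k := by
    rw [e.price_eq, clearingPrice, hσ, add_comm, hyeq]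
    field_simp
  rw [hp]
  refine ⟨hp'.symm, by linarith, by linarith, hs0, by rwa [hp'], fun n => ⟨g n, ?_, fun w => ?_⟩⟩
  · rw [hp']
    exact (foc_iff hN hα hδ hk hk2 hσ0).1 (hfoc n)
  · rcases lt_trichotomy w (supply δ (b n) (σ / k)) with hw | hw | hw
    · exact hleft n w hw
    · simp [hw]
    -- A zero bid would mean supply `δ`, exceeding the total supply `δ - y` because `y > 0`.
    · refine hright n ((e.bid_nonneg n).lt_of_ne fun h0 => ?_) w hw
      have h1 := Finset.single_le_sum (fun m _ => hs0 m) (Finset.mem_univ n)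
      rw [hsum, ← h0, supply, zero_div] at h1
      linarith

end Equilibrium

end ColoEDR

theorem mainTheorem1 (N : ℕ) (hN : 0 < N) (α δ : ℝ) (hα : 0 < α) (hδ : 0 < δ)
    (c : Fin N → ℝ → ℝ)
    (hc : ∀ n, ColoEDR.IsTenantCost (c n))
    (hcheap : ColoEDR.CheapOnSite α δ c)
    (hmc : ∀ n, α / (2 * N) ≤ ColoEDR.rightDeriv (c n) 0) :
    (∃! e : (Fin N → ℝ) × ℝ × ℝ, ColoEDR.IsEquilibrium α δ c e.1 e.2.1 e.2.2) ∧
    (∀ n, ∀ s : ℝ, 0 ≤ s → IntervalIntegrable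
      (ColoEDR.modifiedIntegrand N α δ (c n)) MeasureTheory.volume 0 s) ∧
    ∀ (b : Fin N → ℝ) (p y : ℝ), ColoEDR.IsEquilibrium α δ c b p y →
      0 < p ∧
      ((fun n => ColoEDR.supply δ (b n) p, y) : (Fin N → ℝ) × ℝ) ∈ ColoEDR.feasible N δ ∧
      IsMinOn (ColoEDR.modifiedObjective α δ c) (ColoEDR.feasible N δ)
        (fun n => ColoEDR.supply δ (b n) p, y) ∧
      ∀ q ∈ ColoEDR.feasible N δ,
        IsMinOn (ColoEDR.modifiedObjective α δ c) (ColoEDR.feasible N δ) q →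
        q = (fun n => ColoEDR.supply δ (b n) p, y) := by
  have hT : ∀ n, ColoEDR.IsTenant N α δ (c n) := fun n => ⟨hc n, hN, hα, hδ, hmc n⟩
  have hlt := fun (s : Fin N → ℝ) (y : ℝ) (k : ColoEDR.IsKkt α δ c s y) q hq hne =>
    k.modifiedObjective_lt (q := q) hT hN hα hδ hq hne
  refine ⟨?_, fun n s hs => (hT n).intervalIntegrable_modifiedIntegrand le_rfl hs, ?_⟩
  · obtain ⟨⟨s, y⟩, hf, hmin⟩ := ColoEDR.exists_isMinOn_modifiedObjective hT hδ
    obtain ⟨b, p, e⟩ :=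
      (ColoEDR.isKkt_of_isMinOn hT hN hα hδ hcheap hf hmin).exists_isEquilibrium hT hN hα hδ
    refine ⟨(b, p, y), e, ?_⟩
    rintro ⟨b', p', y'⟩ e'
    obtain ⟨hp, k⟩ := e.isKkt hT hN hα hδ hcheap
    obtain ⟨hp', k'⟩ := e'.isKkt hT hN hα hδ hcheap
    simp only at e' hp' k'
    have heq : ((fun n => ColoEDR.supply δ (b' n) p', y') : (Fin N → ℝ) × ℝ) =
        (fun n => ColoEDR.supply δ (b n) p, y) := by
      by_contra hne
      exact lt_asymm (hlt _ _ k _ k'.mem_feasible hne)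
        (hlt _ _ k' _ k.mem_feasible (Ne.symm hne))
    obtain ⟨hs, hy⟩ := Prod.mk.inj heq
    subst hy
    have hpp : p' = p := by rw [hp, hp']
    subst hpp
    have hp0 : p' ≠ 0 := (((hT ⟨0, hN⟩).share_pos.trans_le k.le_price).trans_eq hp.symm).ne'
    have hb : b' = b := by
      funext n
      have := congrFun hs n
      simp only [ColoEDR.supply, sub_right_inj] at this
      exact (div_left_inj' hp0).1 this
    rw [hb]
  · intro b p y e
    obtain ⟨hp, k⟩ := e.isKkt hT hN hα hδ hcheap
    refine ⟨((hT ⟨0, hN⟩).share_pos.trans_le k.le_price).trans_eq hp.symm, k.mem_feasible,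
      fun q hq => ?_, fun q hq hqmin => ?_⟩
    · by_cases hne : q = (fun n => ColoEDR.supply δ (b n) p, y)
      · rw [hne]
        exact le_refl (ColoEDR.modifiedObjective α δ c _)
      · exact (hlt _ _ k q hq hne).le
    · by_contra hne
      exact absurd (hqmin k.mem_feasible) (hlt _ _ k q hq hne).not_ge
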